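/- Let $\mathcal A$ be a unital $C^*$-algebra, regarded as a right Hilbert module over itself with $\langle x,y\rangle=x^*y$, and let $B(\mathcal A)$ be the algebra of bounded $\mathcal A$-linear operators on $\mathcal A$, identified with $\mathcal A$ via left multipliers $a\mapsto L_a$. Let $\mathcal F\subseteq\mathcal A$ be an ideal of finite type elements, that is, a (not necessarily closed) selfadjoint two-sided ideal such that (a) there is an approximate unit for $\mathcal F$ consisting of orthogonal projections in $\mathcal F$, and (b) for all orthogonal projections $p,q\in\mathcal F$ there is $v\in\mathcal A$ with $vv^*=q$ and $v^*v\,p=0$. Orthogonal projections $p,q$ are called equivalent, $p\sim q$, if $vv^*=p$ and $v^*v=q$ for some $v\in\mathcal A$. The set of equivalence classes of orthogonal projections in $\mathcal F$ is a commutative monoid under addition of orthogonal representatives; $K(\mathcal F)$ is its Grothendieck group and $[p]\in K(\mathcal F)$ is the class of $p$. For a submodule $X$ of $\mathcal A$ write $X=M\,\tilde\oplus\,N$ if $M,N$ are closed submodules of $\mathcal A$ with $M\cap N=\{0\}$ and $M+N=X$. If $N$ is a closed, complementable submodule of $\mathcal A$, then $P_N$ denotes the orthogonal projection of $\mathcal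 A$ onto $N$. For $T\in B(\mathcal A)$ with $T(X)\subseteq X$, where $X$ is closed and complementable in $\mathcal A$, an $\mathcal F$-decomposition of $T|_X$ consists of decompositions $$X=M_1\,\tilde\oplus\,N_1\stackrel{T}{\longrightarrow}M_2\,\tilde\oplus\,N_2=X$$ with respect to which $T|_X$ has the matrix $\begin{pmatrix}T_1&0\\0&T_4\end{pmatrix}$, where $T_1:M_1\to M_2$ is an isomorphism (bounded with bounded inverse) and $P_{N_1},P_{N_2}\in\mathcal F$. Let $\mathcal{MK}\Phi(\mathcal A)$ be the set of all $F\in B(\mathcal A)$ that have an $\mathcal F$-decomposition on $X=\mathcal A$, and for such $F$ put $\operatorname{index}F=[P_{N_1}]-[P_{N_2}]\in K(\mathcal F)$, computed from any such decomposition. **Proposition.** Let $F\in B(\mathcal A)$ and let $\Pi\in B(\mathcal A)$ be a skew or orthogonal projection (that is, $\Pi^2=\Pi$) such that $I-\Pi\in\mathcal F$. Then $F\in\mathcal{MK}\Phi(\mathcal A)$ if and only if there is an $\mathcal F$-decomposition $$\operatorname{Im}\Pi=M\,\tilde\oplus\,N\stackrel{\Pi F}{\longrightarrow}M'\,\tilde\oplus\,N'=\operatorname{Im}\Pi$$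 of $\Pi F|_{\operatorname{Im}\Pi}$, i.e. the matrix of $\Pi F|_{\operatorname{Im}\Pi}$ is diagonal, its first block $(\Pi F)_1:M\to M'$ is an isomorphism, and $P_N,P_{N'}\in\mathcal F$. Moreover, in this case, for every such decomposition, $$\operatorname{index}F=[P_N]-[P_{N'}],$$ where $\operatorname{index}F$ does not depend on the $\mathcal F$-decomposition of $F$ used to compute it. -/

import Mathlib

open scoped Topology MulOpposite

/-- Murray–von Neumann equivalence, used for projections `p`, `q` of `A`. -/
def MvNEquiv {A : Type*} [Mul A] [Star A] (p q : A) : Prop :=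
  ∃ v : A, v * star v = p ∧ star v * v = q

/-- An ideal of finite type elements of a unital C⋆-algebra: a (not necessarily closed)
selfadjoint two-sided ideal having an approximate unit of projections, and in which every
projection is equivalent to one orthogonal to any prescribed projection.
The approximate unit is given by a proper filter; a net `(p_α)` corresponds to the filter
generated by its tails. -/
structure FiniteTypeIdeal (A : Type*) [CStarAlgebra A] where
  toIdeal : TwoSidedIdeal A
  star_mem : ∀ a ∈ toIdeal, star a ∈ toIdeal
  exists_approx_unit : ∃ l : Filter A, l.NeBot ∧
    (∀ᶠ p in l, p ∈ toIdeal ∧ IsStarProjection p) ∧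
    ∀ f ∈ toIdeal, Filter.Tendsto (fun p => p * f) l (𝓝 f) ∧
      Filter.Tendsto (fun p => f * p) l (𝓝 f)
  exists_orthogonal : ∀ p ∈ toIdeal, ∀ q ∈ toIdeal, IsStarProjection p → IsStarProjection q →
    ∃ v : A, v * star v = q ∧ (star v * v) * p = 0

namespace MvNEquiv

variable {A : Type*} [CStarAlgebra A]

theorem refl {p : A} (hp : IsStarProjection p) : MvNEquiv p p :=
  ⟨p, by rw [hp.isSelfAdjoint.star_eq, hp.isIdempotentElem.eq],
    by rw [hp.isSelfAdjoint.star_eq, hp.isIdempotentElem.eq]⟩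

theorem symm {p q : A} : MvNEquiv p q → MvNEquiv q p := by
  rintro ⟨v, h1, h2⟩
  exact ⟨star v, by rw [star_star, h2], by rw [star_star, h1]⟩

theorem trans {p q r : A} (hp : IsStarProjection p) (hr : IsStarProjection r)
    (h : MvNEquiv p q) (h' : MvNEquiv q r) : MvNEquiv p r := by
  obtain ⟨v, h1, h2⟩ := h
  obtain ⟨w, h3, h4⟩ := h'
  refine ⟨v * w, ?_, ?_⟩
  · calc v * w * star (v * w) = v * (w * star w) * star v := by
          rw [star_mul]; simp only [mul_assoc]
      _ = (v * star v) * (v * star v) := by rw [h3, ← h2]; simp only [mul_assoc]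
      _ = p := by rw [h1, hp.isIdempotentElem.eq]
  · calc star (v * w) * (v * w) = star w * (star v * v) * w := by
          rw [star_mul]; simp only [mul_assoc]
      _ = (star w * w) * (star w * w) := by rw [h2, ← h3]; simp only [mul_assoc]
      _ = r := by rw [h4, hr.isIdempotentElem.eq]

/-- If `v v⋆` is a projection, then `v` is a partial isometry. -/
theorem mul_star_mul_self {v : A} (h : IsStarProjection (v * star v)) :
    v * star v * v = v := by
  rw [← sub_eq_zero, ← CStarRing.mul_star_self_eq_zero_iff]
  have h2 : v * star v * (v * star v) = v * star v := h.isIdempotentElem.eq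
  simp only [star_sub, star_mul, star_star, sub_mul, mul_sub, mul_assoc] at *
  simp only [h2, sub_self]

theorem star_mul_self_isStarProjection {v : A} (h : IsStarProjection (v * star v)) :
    IsStarProjection (star v * v) := by
  refine ⟨?_, IsSelfAdjoint.star_mul_self v⟩
  change star v * v * (star v * v) = star v * v
  rw [mul_assoc, ← mul_assoc v, mul_star_mul_self h]

theorem orthogonal_symm {p q : A} (hp : IsStarProjection p) (hq : IsStarProjection q)
    (h : p * q = 0) : q * p = 0 := by
  have := congrArg star h
  rwa [star_mul, hp.isSelfAdjoint.star_eq, hq.isSelfAdjoint.star_eq, star_zero] at this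

theorem add {p q p' q' : A} (hp : IsStarProjection p) (hq : IsStarProjection q)
    (h : p * q = 0) (h' : p' * q' = 0)
    (e : MvNEquiv p p') (f : MvNEquiv q q') : MvNEquiv (p + q) (p' + q') := by
  obtain ⟨v, h1, h2⟩ := e
  obtain ⟨w, h3, h4⟩ := f
  have hv : v * star v * v = v := mul_star_mul_self (h1 ▸ hp)
  have hw : w * star w * w = w := mul_star_mul_self (h3 ▸ hq)
  have hvs : star v * v * star v = star v := by
    have := congrArg star hv
    simpa only [star_mul, star_star, mul_assoc] using this
  have hws : star w * w * star w = star w := by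
    have := congrArg star hw
    simpa only [star_mul, star_star, mul_assoc] using this
  have a1 : v * star w = 0 := by
    calc v * star w = (v * star v * v) * (star w * w * star w) := by rw [hv, hws]
      _ = v * ((star v * v) * (star w * w)) * star w := by simp only [mul_assoc]
      _ = 0 := by rw [h2, h4, h', mul_zero, zero_mul]
  have a2 : w * star v = 0 := by
    have := congrArg star a1
    simpa only [star_mul, star_star, star_zero] using this
  have a3 : star v * w = 0 := by
    calc star v * w = (star v * v * star v) * (w * star w * w) := by rw [hvs, hw]
      _ = star v * ((v * star v) * (w * star w)) * w := by simp only [mul_assoc]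
      _ = 0 := by rw [h1, h3, h, mul_zero, zero_mul]
  have a4 : star w * v = 0 := by
    have := congrArg star a3
    simpa only [star_mul, star_star, star_zero] using this
  refine ⟨v + w, ?_, ?_⟩
  · rw [star_add, add_mul, mul_add, mul_add, h1, h3, a1, a2, add_zero, zero_add]
  · rw [star_add, add_mul, mul_add, mul_add, h2, h4, a3, a4, add_zero, zero_add]

end MvNEquiv

namespace FiniteTypeIdeal

variable {A : Type*} [CStarAlgebra A] (𝓕 : FiniteTypeIdeal A)

/-- The set of orthogonal projections of `A` lying in `𝓕`. -/
abbrev Proj : Type _ := {p : A // p ∈ 𝓕.toIdeal ∧ IsStarProjection p}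

variable {𝓕}

theorem Proj.isProj (p : 𝓕.Proj) : IsStarProjection p.1 := p.2.2

variable (𝓕)

instance projSetoid : Setoid 𝓕.Proj where
  r p q := MvNEquiv p.1 q.1
  iseqv := ⟨fun p => MvNEquiv.refl p.isProj, fun h => h.symm,
    fun {p _ r} h h' => MvNEquiv.trans p.isProj r.isProj h h'⟩

/-- The set `S(𝓕)` of Murray–von Neumann classes of projections in `𝓕`. -/
def S : Type _ := Quotient 𝓕.projSetoid

variable {𝓕}

theorem Proj.add_isProj {p q : 𝓕.Proj} (h : p.1 * q.1 = 0) : IsStarProjection (p.1 + q.1) := by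
  refine ⟨?_, p.isProj.isSelfAdjoint.add q.isProj.isSelfAdjoint⟩
  change (p.1 + q.1) * (p.1 + q.1) = p.1 + q.1
  rw [add_mul, mul_add, mul_add, h, MvNEquiv.orthogonal_symm p.isProj q.isProj h,
    p.isProj.isIdempotentElem.eq, q.isProj.isIdempotentElem.eq, add_zero, zero_add]

/-- The sum of two orthogonal projections in `𝓕`. -/
def Proj.orthAdd (p q : 𝓕.Proj) (h : p.1 * q.1 = 0) : 𝓕.Proj :=
  ⟨p.1 + q.1, 𝓕.toIdeal.add_mem p.2.1 q.2.1, Proj.add_isProj h⟩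

theorem Proj.exists_orth (p q : 𝓕.Proj) :
    ∃ q' : 𝓕.Proj, p.1 * q'.1 = 0 ∧ MvNEquiv q.1 q'.1 := by
  obtain ⟨v, h1, h2⟩ := 𝓕.exists_orthogonal p.1 p.2.1 q.1 q.2.1 p.2.2 q.2.2
  have hv : IsStarProjection (v * star v) := h1 ▸ q.isProj
  have hproj := MvNEquiv.star_mul_self_isStarProjection hv
  refine ⟨⟨star v * v, ?_, hproj⟩, MvNEquiv.orthogonal_symm hproj p.isProj h2, v, h1, rfl⟩
  have : star v * v = star v * ((v * star v) * v) := by rw [MvNEquiv.mul_star_mul_self hv]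
  rw [this, h1]
  exact 𝓕.toIdeal.mul_mem_left _ _ (𝓕.toIdeal.mul_mem_right _ _ q.2.1)

/-- A representative of the sum of the classes of `p` and `q`: the sum of `p` and of a
projection equivalent to `q` and orthogonal to `p`. -/
noncomputable def Proj.add (p q : 𝓕.Proj) : 𝓕.Proj :=
  p.orthAdd (p.exists_orth q).choose (p.exists_orth q).choose_spec.1

/-- The class of `Proj.add p q` is that of `p' + q'` for any orthogonal `p' ∼ p`, `q' ∼ q`. -/
theorem Proj.add_equiv (p q p' q' : 𝓕.Proj) (h : p'.1 * q'.1 = 0)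
    (e : MvNEquiv p.1 p'.1) (f : MvNEquiv q.1 q'.1) :
    MvNEquiv (p.add q).1 (p'.1 + q'.1) := by
  have hs := (p.exists_orth q).choose_spec
  set r := (p.exists_orth q).choose with hr
  have : MvNEquiv r.1 q'.1 := MvNEquiv.trans r.isProj q'.isProj hs.2.symm f
  exact MvNEquiv.add p.isProj r.isProj hs.1 h e this

noncomputable instance : Add 𝓕.S where
  add := Quotient.map₂ Proj.add (by
    intro p p' e q q' f
    have hs := (p'.exists_orth q').choose_spec
    exact Proj.add_equiv p q p' _ hs.1 e
      (MvNEquiv.trans q.isProj (Proj.isProj _) f hs.2))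

instance : Zero 𝓕.S where
  zero := Quotient.mk _ ⟨0, 𝓕.toIdeal.zero_mem, IsStarProjection.zero A⟩

variable (𝓕) in
/-- The class of a projection in `S(𝓕)`. -/
def toS (p : 𝓕.Proj) : 𝓕.S := Quotient.mk _ p

/-- Addition of classes is given by addition of orthogonal projections. -/
theorem toS_add (p q : 𝓕.Proj) (h : p.1 * q.1 = 0) :
    𝓕.toS p + 𝓕.toS q = 𝓕.toS (p.orthAdd q h) :=
  Quotient.sound (Proj.add_equiv p q p q h (MvNEquiv.refl p.isProj) (MvNEquiv.refl q.isProj))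

theorem toS_eq {p q : 𝓕.Proj} (h : MvNEquiv p.1 q.1) : 𝓕.toS p = 𝓕.toS q :=
  Quotient.sound h

theorem S.add_comm' (a b : 𝓕.S) : a + b = b + a := by
  induction a using Quotient.inductionOn with | _ p
  induction b using Quotient.inductionOn with | _ q
  change 𝓕.toS p + 𝓕.toS q = 𝓕.toS q + 𝓕.toS p
  obtain ⟨q', h, e⟩ := p.exists_orth q
  rw [toS_eq e, toS_add p q' h, toS_add q' p (MvNEquiv.orthogonal_symm p.isProj q'.isProj h)]
  exact congrArg 𝓕.toS (Subtype.ext (add_comm _ _))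

theorem S.zero_add' (a : 𝓕.S) : 0 + a = a := by
  induction a using Quotient.inductionOn with | _ p
  change 𝓕.toS ⟨0, 𝓕.toIdeal.zero_mem, IsStarProjection.zero A⟩ + 𝓕.toS p = 𝓕.toS p
  rw [toS_add _ _ (zero_mul _)]
  exact congrArg 𝓕.toS (Subtype.ext (zero_add _))

theorem S.add_assoc' (a b c : 𝓕.S) : a + b + c = a + (b + c) := by
  induction a using Quotient.inductionOn with | _ p
  induction b using Quotient.inductionOn with | _ q
  induction c using Quotient.inductionOn with | _ r
  change 𝓕.toS p + 𝓕.toS q + 𝓕.toS r = 𝓕.toS p + (𝓕.toS q + 𝓕.toS r)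
  obtain ⟨q', h, e⟩ := p.exists_orth q
  obtain ⟨r', h', e'⟩ := (p.orthAdd q' h).exists_orth r
  have h1 : (p.1 + q'.1) * r'.1 = 0 := h'
  have hpr : p.1 * r'.1 = 0 := by
    have := congrArg (p.1 * ·) h1
    simpa only [← mul_assoc, mul_add, h, p.isProj.isIdempotentElem.eq, add_zero, mul_zero]
      using this
  have hqr : q'.1 * r'.1 = 0 := by rwa [add_mul, hpr, zero_add] at h1
  have hpqr : p.1 * (q'.orthAdd r' hqr).1 = 0 := by
    change p.1 * (q'.1 + r'.1) = 0
    rw [mul_add, h, hpr, add_zero]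
  rw [toS_eq e, toS_eq e', toS_add p q' h, toS_add _ r' h', toS_add q' r' hqr,
    toS_add p _ hpqr]
  exact congrArg 𝓕.toS (Subtype.ext (add_assoc _ _ _))

noncomputable instance : AddCommMonoid 𝓕.S where
  add_assoc := S.add_assoc'
  zero_add := S.zero_add'
  add_zero a := by rw [S.add_comm', S.zero_add']
  add_comm := S.add_comm'
  nsmul := nsmulRec

variable (𝓕)

/-- The group `K(𝓕)`. -/
abbrev K : Type _ := Algebra.GrothendieckAddGroup 𝓕.S

/-- The class `[p]` in `K(𝓕)` of a projection `p` in `𝓕`. -/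
noncomputable def cls (p : 𝓕.Proj) : 𝓕.K := Algebra.GrothendieckAddGroup.of (𝓕.toS p)

end FiniteTypeIdeal

/- Below, `A` is the right Hilbert module over itself, with inner product `⟨x, y⟩ = x⋆ y`:
closed submodules are closed `Submodule Aᵐᵒᵖ A`, and `B(A)` is `A →L[Aᵐᵒᵖ] A`. -/

/-- The left multiplier `L_a`; `a ↦ L_a` identifies `A` with `B(A)`. -/
def leftMultiplier {A : Type*} [CStarAlgebra A] (a : A) : A →L[Aᵐᵒᵖ] A where
  toFun x := a * x
  map_add' := mul_add a
  map_smul' m x := (mul_assoc a x m.unop).symm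
  cont := continuous_const.mul continuous_id

/-- `P` is the orthogonal projection of the Hilbert module `A` onto the submodule `N`. -/
def IsOrthogonalProjectionOnto {A : Type*} [CStarAlgebra A] (P : A →L[Aᵐᵒᵖ] A)
    (N : Submodule Aᵐᵒᵖ A) : Prop :=
  ∀ x, P x ∈ N ∧ ∀ y ∈ N, star y * (x - P x) = 0

/-- `X = M ⊕̃ N`: the closed submodules `M`, `N` have zero intersection and sum `X`. -/
structure IsTopDirectSum {A : Type*} [CStarAlgebra A] (X M N : Submodule Aᵐᵒᵖ A) : Prop where
  isClosed_left : IsClosed (M : Set A)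
  isClosed_right : IsClosed (N : Set A)
  inf_eq_bot : M ⊓ N = ⊥
  sup_eq : M ⊔ N = X

namespace FiniteTypeIdeal

variable {A : Type*} [CStarAlgebra A] (𝓕 : FiniteTypeIdeal A)

/-- The ideal `𝓕`, viewed inside `B(A)`. -/
def operators : Set (A →L[Aᵐᵒᵖ] A) := leftMultiplier '' {a | a ∈ 𝓕.toIdeal}

/-- With respect to `X = M₁ ⊕̃ N₁ → M₂ ⊕̃ N₂ = X`, the restriction of `T` to `X` has a diagonal
matrix whose first block `M₁ → M₂` is an isomorphism, and the orthogonal projections of `A` onto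
`N₁` and `N₂` are the elements `p` and `q` of `𝓕`. -/
structure IsDecomposition (T : A →L[Aᵐᵒᵖ] A) (X M₁ N₁ M₂ N₂ : Submodule Aᵐᵒᵖ A)
    (p q : 𝓕.Proj) : Prop where
  domain : IsTopDirectSum X M₁ N₁
  codomain : IsTopDirectSum X M₂ N₂
  iso : ∃ e : M₁ ≃L[Aᵐᵒᵖ] M₂, ∀ x : M₁, (e x : A) = T x
  map_compl : ∀ x ∈ N₁, T x ∈ N₂
  proj_domain : IsOrthogonalProjectionOnto (leftMultiplier p.1) N₁
  proj_codomain : IsOrthogonalProjectionOnto (leftMultiplier q.1) N₂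

/-- The set `MKΦ(A)`: operators with a decomposition as above of the whole module `A`. -/
def MKPhi : Set (A →L[Aᵐᵒᵖ] A) :=
  {F | ∃ (M₁ N₁ M₂ N₂ : Submodule Aᵐᵒᵖ A) (p q : 𝓕.Proj), 𝓕.IsDecomposition F ⊤ M₁ N₁ M₂ N₂ p q}

open Classical in
/-- The index `[P_{N₁}] - [P_{N₂}] ∈ K(𝓕)` of `F ∈ MKΦ(A)`, computed from some decomposition
of `F` (and `0` by convention if `F ∉ MKΦ(A)`). -/
noncomputable def index (F : A →L[Aᵐᵒᵖ] A) : 𝓕.K :=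
  if h : ∃ k : 𝓕.K, ∃ (M₁ N₁ M₂ N₂ : Submodule Aᵐᵒᵖ A) (p q : 𝓕.Proj),
      𝓕.IsDecomposition F ⊤ M₁ N₁ M₂ N₂ p q ∧ k = 𝓕.cls p - 𝓕.cls q
  then h.choose else 0

end FiniteTypeIdeal

/-! Every operator is a left multiplier, so the whole question moves into the ring `A`. A
decomposition of `L_t` on the range of an idempotent `e` amounts to an outer inverse `u` (`u t u =
u`) in the corner of `e` for which the idempotents `e - u t e` and `e - t u` lie in `𝓕`; their
ranges play the roles of `N₁` and `N₂`. Projections that are equivalent as idempotents are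
Murray–von Neumann equivalent, so `K(𝓕)`-classes can be computed with idempotents (`idemCls`).

The index is independent of `u` because, for a large projection `p ∈ 𝓕`, both `u f` and `v f` have
left inverses on `(1 - p)A`. By `idemCls_sub_eq_of_leftInverse` each index is then `[p]` minus the
class of an idempotent with kernel `f(1 - p)A`, and idempotents with a common kernel are equivalent
(`idemCls_sub_eq`).

For `1 - e ∈ 𝓕`, an outer inverse of `e f` in the corner is one of `f` in `A`. Both of its defects
grow by `[1 - e]`, which cancels in the index (`idemCls_sub_corner`). Conversely, cutting an inverse
modulo `𝓕` down to the corner and correcting it by a compression gives an outer inverse there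
(`exists_outerInverse_corner`). -/

/-! ### Equivalence of idempotents in a ring -/

/-- Algebraic equivalence of idempotents: `n = a b` and `m = b a`. -/
def IdemEquiv {R : Type*} [Mul R] (n m : R) : Prop :=
  ∃ a b : R, a * b = n ∧ b * a = m

namespace IdemEquiv

variable {R : Type*} [Ring R]

theorem symm {n m : R} : IdemEquiv n m → IdemEquiv m n := by
  rintro ⟨a, b, h1, h2⟩
  exact ⟨b, a, h2, h1⟩

theorem trans {n m l : R} (hn : IsIdempotentElem n) (hl : IsIdempotentElem l)
    (h : IdemEquiv n m) (h' : IdemEquiv m l) : IdemEquiv n l := by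
  obtain ⟨a, b, h1, h2⟩ := h
  obtain ⟨c, d, h3, h4⟩ := h'
  have hn : n * n = n := hn
  have hl : l * l = l := hl
  refine ⟨a * c, d * b, ?_, ?_⟩
  · linear_combination (norm := noncomm_ring)
      a * h3 * b - a * h2 * b + h1 * (a * b) + n * h1 + hn
  · linear_combination (norm := noncomm_ring)
      d * h2 * c - d * h3 * c + h4 * (d * c) + l * h4 + hl

/-- Equivalence can be implemented by elements of the corners `n R m` and `m R n`. -/
theorem exists_corner {n m : R} (hn : IsIdempotentElem n) (hm : IsIdempotentElem m)
    (h : IdemEquiv n m) :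
    ∃ a b : R, a * b = n ∧ b * a = m ∧ n * a = a ∧ a * m = a ∧ m * b = b ∧ b * n = b := by
  obtain ⟨a, b, h1, h2⟩ := h
  have hn : n * n = n := hn
  have hm : m * m = m := hm
  have ham : a * m = n * a := by rw [← h1, ← h2, mul_assoc]
  have hbn : b * n = m * b := by rw [← h1, ← h2, mul_assoc]
  refine ⟨n * a, m * b, ?_, ?_, ?_, ?_, ?_, ?_⟩
  · rw [← hbn, mul_assoc, ← mul_assoc a, h1, hn, hn]
  · rw [← ham, mul_assoc, ← mul_assoc b, h2, hm, hm]
  · rw [← mul_assoc, hn]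
  · rw [mul_assoc, ham, ← mul_assoc, hn]
  · rw [← mul_assoc, hm]
  · rw [mul_assoc, hbn, ← mul_assoc, hm]

theorem add {n m n' m' : R} (hn : IsIdempotentElem n) (hm : IsIdempotentElem m)
    (hn' : IsIdempotentElem n') (hm' : IsIdempotentElem m')
    (h₁ : n * m = 0) (h₂ : m * n = 0) (h₁' : n' * m' = 0) (h₂' : m' * n' = 0)
    (e : IdemEquiv n n') (f : IdemEquiv m m') : IdemEquiv (n + m) (n' + m') := by
  obtain ⟨a, b, ab, ba, na, an, nb, bn⟩ := e.exists_corner hn hn'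
  obtain ⟨c, d, cd, dc, mc, cm, md, dm⟩ := f.exists_corner hm hm'
  -- With the implementing elements in corners, orthogonality kills all cross terms.
  have ad : a * d = 0 := by rw [← an, ← md, mul_assoc, ← mul_assoc n', h₁', zero_mul, mul_zero]
  have cb : c * b = 0 := by rw [← cm, ← nb, mul_assoc, ← mul_assoc m', h₂', zero_mul, mul_zero]
  have bc : b * c = 0 := by rw [← bn, ← mc, mul_assoc, ← mul_assoc n, h₁, zero_mul, mul_zero]
  have da : d * a = 0 := by rw [← dm, ← na, mul_assoc, ← mul_assoc m, h₂, zero_mul, mul_zero]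
  refine ⟨a + c, b + d, ?_, ?_⟩
  · rw [add_mul, mul_add, mul_add, ab, cd, ad, cb, add_zero, zero_add]
  · rw [add_mul, mul_add, mul_add, ba, dc, bc, da, add_zero, zero_add]

/-- Idempotents with the same range are equivalent. -/
theorem of_range_eq {n m : R} (h : m * n = n) (h' : n * m = m) : IdemEquiv n m :=
  ⟨m, n, h, h'⟩

/-- Idempotents with the same kernel are equivalent. -/
theorem of_ker_eq {n m : R} (h : n * m = n) (h' : m * n = m) : IdemEquiv n m :=
  ⟨n, m, h, h'⟩

/-- Since `n = n² = a (b a) b = a m b`, a two-sided ideal absorbs equivalent idempotents. -/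
theorem mem {I : TwoSidedIdeal R} {n m : R} (hn : IsIdempotentElem n) (h : IdemEquiv n m)
    (hm : m ∈ I) : n ∈ I := by
  obtain ⟨a, b, h1, h2⟩ := h
  have : n = a * m * b := by
    rw [← hn.eq, ← h2, ← h1]
    simp only [mul_assoc]
  rw [this]
  exact I.mul_mem_right _ _ (I.mul_mem_left _ _ hm)

end IdemEquiv

/-! ### Idempotents and projections in a C⋆-algebra -/

section CStar

variable {A : Type*} [CStarAlgebra A]

/-- Algebraically equivalent projections of a C⋆-algebra are Murray–von Neumann equivalent. -/
theorem IdemEquiv.mvNEquiv {p q : A} (hp : IsStarProjection p) (hq : IsStarProjection q)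
    (h : IdemEquiv p q) : MvNEquiv p q := by
  let _ := CStarAlgebra.spectralOrder A
  have _ := CStarAlgebra.spectralOrderedRing A
  obtain ⟨a, b, ab, ba, pa, aq, qb, bp⟩ :=
    h.exists_corner hp.isIdempotentElem hq.isIdempotentElem
  have hba : star a * star b = q := by rw [← star_mul, ba, hq.isSelfAdjoint.star_eq]
  have hab : star b * star a = p := by rw [← star_mul, ab, hp.isSelfAdjoint.star_eq]
  have h1 : star a * a * (b * star b) = q := by
    rw [mul_assoc, ← mul_assoc a, ab, ← mul_assoc, ← hp.isSelfAdjoint.star_eq, ← star_mul, pa,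
      hba]
  have h2 : b * star b * (star a * a) = q := by
    rw [mul_assoc, ← mul_assoc (star b), hab, pa, ba]
  have hnn : 0 ≤ b * star b := mul_star_self_nonneg b
  have hs : CFC.sqrt (b * star b) * CFC.sqrt (b * star b) = b * star b :=
    CFC.sqrt_mul_sqrt_self _ hnn
  have hsa : star (CFC.sqrt (b * star b)) = CFC.sqrt (b * star b) :=
    (CFC.sqrt_nonneg (b * star b)).isSelfAdjoint.star_eq
  have hc : Commute (CFC.sqrt (b * star b)) (star a * a) := by
    have : Commute (b * star b) (star a * a) := by rw [Commute, SemiconjBy, h1, h2]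
    exact this.cfcₙ_nnreal _
  -- Polar decomposition: `b b⋆` inverts `a⋆ a` in the corner of `q`, so this is `a |a|⁻¹`.
  refine ⟨a * CFC.sqrt (b * star b), ?_, ?_⟩
  · rw [star_mul, hsa, mul_assoc, ← mul_assoc (CFC.sqrt _), hs, mul_assoc b, hab, bp, ab]
  · rw [star_mul, hsa, mul_assoc, ← mul_assoc (star a), ← hc.eq, ← mul_assoc, hs, h2]

/-- The range of an idempotent of a C⋆-algebra is the range of a projection. -/
theorem exists_range_projection {n : A} (hn : IsIdempotentElem n) :
    ∃ p : A, IsStarProjection p ∧ p * n = n ∧ n * p = p := by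
  let _ := CStarAlgebra.spectralOrder A
  have _ := CStarAlgebra.spectralOrderedRing A
  have hn : n * n = n := hn
  have hn' : star n * star n = star n := by rw [← star_mul, hn]
  -- This `z ≥ 1` is invertible and commutes with `n` and `n⋆`. As `n z = n n⋆ n`, the range
  -- projection is `n n⋆ z⁻¹`.
  set z : A := 1 + star (n - star n) * (n - star n) with hz
  have hzu : IsUnit z :=
    CStarAlgebra.isUnit_of_le 1 (le_add_of_nonneg_right (star_mul_self_nonneg _))
  have hz' : z = 1 + star n * n - star n - n + n * star n := by
    rw [hz, star_sub, star_star]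
    linear_combination (norm := noncomm_ring) -hn - hn'
  have hzs : star z = z := by rw [hz]; simp
  have h1 : n * z = n * star n * n := by
    rw [hz']
    linear_combination (norm := noncomm_ring) -hn + hn * star n
  have h2 : z * n = n * star n * n := by
    rw [hz']
    linear_combination (norm := noncomm_ring) star n * hn - hn
  have hcn : Commute z n := h2.trans h1.symm
  have hcs : Commute z (star n) := by
    have := congrArg star hcn.eq
    rw [star_mul, star_mul, hzs] at this
    exact this.symm
  clear_value z
  obtain ⟨y, rfl⟩ := hzu
  have cn : (↑y⁻¹ : A) * n = n * ↑y⁻¹ := hcn.units_inv_left.eq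
  have cs : (↑y⁻¹ : A) * star n = star n * ↑y⁻¹ := hcs.units_inv_left.eq
  have hys : star (↑y⁻¹ : A) = ↑y⁻¹ := by
    rw [← Units.coe_star, star_inv]
    congr 2
    exact Units.ext hzs
  have hpn : n * star n * ↑y⁻¹ * n = n := by
    rw [mul_assoc, cn, ← mul_assoc, ← h1, mul_assoc, Units.mul_inv, mul_one]
  refine ⟨n * star n * ↑y⁻¹, ⟨?_, ?_⟩, hpn, ?_⟩
  · change n * star n * ↑y⁻¹ * (n * star n * ↑y⁻¹) = _
    rw [← mul_assoc, ← mul_assoc, hpn]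
  · change star (n * star n * ↑y⁻¹) = _
    rw [star_mul, star_mul, star_star, hys, ← mul_assoc, cn, mul_assoc, cs, ← mul_assoc]
  · rw [← mul_assoc, ← mul_assoc, hn]

/-! ### Classes of idempotents in `K(𝓕)` and comparison of indices -/

namespace FiniteTypeIdeal

variable (𝓕 : FiniteTypeIdeal A)

theorem exists_range_proj {n : A} (hn : IsIdempotentElem n) (hmem : n ∈ 𝓕.toIdeal) :
    ∃ p : 𝓕.Proj, p.1 * n = n ∧ n * p.1 = p.1 := by
  obtain ⟨p, hp, h1, h2⟩ := exists_range_projection hn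
  exact ⟨⟨p, h2 ▸ 𝓕.toIdeal.mul_mem_right _ _ hmem, hp⟩, h1, h2⟩

open Classical in
/-- The class in `K(𝓕)` of an idempotent of `𝓕`: the class of any equivalent projection
(and `0` by convention if there is none). -/
noncomputable def idemCls (n : A) : 𝓕.K :=
  if h : ∃ p : 𝓕.Proj, IdemEquiv n p.1 then 𝓕.cls h.choose else 0

variable {𝓕}

theorem cls_eq {p q : 𝓕.Proj} (h : IdemEquiv p.1 q.1) : 𝓕.cls p = 𝓕.cls q :=
  congrArg Algebra.GrothendieckAddGroup.of (toS_eq (h.mvNEquiv p.isProj q.isProj))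

/-- The choice in `idemCls` is harmless: projections equivalent to one idempotent are equivalent to
each other. -/
theorem idemCls_eq_cls {n : A} {p : 𝓕.Proj} (h : IdemEquiv n p.1) : 𝓕.idemCls n = 𝓕.cls p := by
  have hex : ∃ p : 𝓕.Proj, IdemEquiv n p.1 := ⟨p, h⟩
  rw [idemCls, dif_pos hex]
  refine cls_eq ?_
  exact hex.choose_spec.symm.trans hex.choose.isProj.isIdempotentElem
    p.isProj.isIdempotentElem h

theorem idemCls_congr {n m : A} (hn : IsIdempotentElem n) (hm : IsIdempotentElem m)
    (hmem : m ∈ 𝓕.toIdeal) (h : IdemEquiv n m) : 𝓕.idemCls n = 𝓕.idemCls m := by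
  obtain ⟨p, h1, h2⟩ := 𝓕.exists_range_proj hm hmem
  have hp : IdemEquiv m p.1 := .of_range_eq h1 h2
  rw [idemCls_eq_cls hp, idemCls_eq_cls (h.trans hn p.isProj.isIdempotentElem hp)]

theorem cls_orthAdd (p q : 𝓕.Proj) (h : p.1 * q.1 = 0) :
    𝓕.cls (p.orthAdd q h) = 𝓕.cls p + 𝓕.cls q := by
  rw [cls, ← toS_add, map_add]
  rfl

theorem idemCls_add {n m : A} (hn : IsIdempotentElem n) (hm : IsIdempotentElem m)
    (hnmem : n ∈ 𝓕.toIdeal) (hmmem : m ∈ 𝓕.toIdeal) (h₁ : n * m = 0) (h₂ : m * n = 0) :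
    𝓕.idemCls (n + m) = 𝓕.idemCls n + 𝓕.idemCls m := by
  obtain ⟨p, hp1, hp2⟩ := 𝓕.exists_range_proj hn hnmem
  obtain ⟨q, hq1, hq2⟩ := 𝓕.exists_range_proj hm hmmem
  -- The range projections of orthogonal idempotents need not be orthogonal, so the second is
  -- replaced by an equivalent one.
  obtain ⟨q', hpq, v, hv1, hv2⟩ := p.exists_orth q
  have hp : IdemEquiv n p.1 := .of_range_eq hp1 hp2
  have hq : IdemEquiv m q'.1 :=
    IdemEquiv.trans hm q'.isProj.isIdempotentElem (.of_range_eq hq1 hq2) ⟨v, star v, hv1, hv2⟩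
  rw [idemCls_eq_cls hp, idemCls_eq_cls hq, ← cls_orthAdd p q' hpq]
  exact idemCls_eq_cls (hp.add hn hm p.isProj.isIdempotentElem q'.isProj.isIdempotentElem h₁ h₂
    hpq (MvNEquiv.orthogonal_symm p.isProj q'.isProj hpq) hq)

/-- If `u` is an outer inverse of `f` modulo `𝓕` and `w u` is a left inverse of `f` on the range
of `1 - p`, then the index computed from `u` is the one computed from `w u`. -/
theorem idemCls_sub_eq_of_leftInverse {f u w p : A} (hufu : u * f * u = u)
    (h₁ : 1 - u * f ∈ 𝓕.toIdeal) (h₂ : 1 - f * u ∈ 𝓕.toIdeal)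
    (hp : IsIdempotentElem p) (hpmem : p ∈ 𝓕.toIdeal)
    (hpw : p * w = 0) (hw : w * u * f * (1 - p) = 1 - p) :
    1 - f * w * u ∈ 𝓕.toIdeal ∧
    𝓕.idemCls (1 - u * f) - 𝓕.idemCls (1 - f * u) =
      𝓕.idemCls p - 𝓕.idemCls (1 - f * w * u) := by
  have hwufw : w * u * f * w = w := by
    linear_combination (norm := noncomm_ring) hw * w + (w * u * f) * hpw - hpw
  have n₁ : IsIdempotentElem (1 - u * f) := by
    change (1 - u * f) * (1 - u * f) = 1 - u * f
    linear_combination (norm := noncomm_ring) hufu * f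
  have n₂ : IsIdempotentElem (1 - f * u) := by
    change (1 - f * u) * (1 - f * u) = 1 - f * u
    linear_combination (norm := noncomm_ring) f * hufu
  have hq : IsIdempotentElem (1 - f * w * u) := by
    change (1 - f * w * u) * (1 - f * w * u) = 1 - f * w * u
    linear_combination (norm := noncomm_ring) f * hwufw * u
  -- `c₁` and `c₂` measure the enlargement of the two defects in passing from `u` to `w u`. They are
  -- equivalent via `f` and `u`, so they cancel in the difference.
  set c₁ := u * f - u * f * w * u * f with hc₁
  set c₂ := f * u - f * u * f * w * u with hc₂
  have ic₁ : IsIdempotentElem c₁ := by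
    change c₁ * c₁ = c₁
    rw [hc₁]
    linear_combination (norm := noncomm_ring) hufu * f - hufu * (f * w * u * f)
      - (u * f * w) * hufu * f + (u * f * w) * hufu * (f * w * u * f) + u * f * hwufw * u * f
  have ic₂ : IsIdempotentElem c₂ := by
    change c₂ * c₂ = c₂
    rw [hc₂]
    linear_combination (norm := noncomm_ring) f * hufu - f * hufu * (f * w * u)
      - (f * u * f * w) * hufu + (f * u * f * w) * hufu * (f * w * u) + f * u * f * hwufw * u
  have hc : IdemEquiv c₂ c₁ := by
    refine ⟨c₂ * f, u * c₂, ?_, ?_⟩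
    · have : c₂ * f * u = c₂ := by
        rw [hc₂]
        linear_combination (norm := noncomm_ring) f * hufu - f * u * f * w * hufu
      rw [← mul_assoc, this]
      exact ic₂
    · rw [← mul_assoc, mul_assoc u, ic₂.eq, hc₁, hc₂]
      linear_combination (norm := noncomm_ring) hufu * f - hufu * (f * w * u * f)
  have is' : IsIdempotentElem (1 - w * u * f) := by
    change (1 - w * u * f) * (1 - w * u * f) = 1 - w * u * f
    linear_combination (norm := noncomm_ring) hwufw * u * f
  have n₁c₁ : (1 - u * f) * c₁ = 0 := by
    rw [hc₁]
    linear_combination (norm := noncomm_ring) -hufu * f + hufu * (f * w * u * f)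
  have c₁n₁ : c₁ * (1 - u * f) = 0 := by
    rw [hc₁]
    linear_combination (norm := noncomm_ring) -hufu * f + u * f * w * hufu * f
  have hs : 1 - u * f + c₁ = 1 - u * f * w * u * f := by rw [hc₁]; abel
  have is : IsIdempotentElem (1 - u * f + c₁) := by
    change _ * _ = _
    rw [add_mul, mul_add, mul_add, n₁.eq, ic₁.eq, n₁c₁, c₁n₁, add_zero, zero_add]
  have hss' : IdemEquiv (1 - u * f + c₁) (1 - w * u * f) := by
    rw [hs]
    refine .of_range_eq ?_ ?_
    · linear_combination (norm := noncomm_ring) w * hufu * f * w * u * f + hwufw * u * f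
    · linear_combination (norm := noncomm_ring) u * f * hwufw * u * f
  -- Both kernels are `(1 - p)A`, the range of `w u f`.
  have hs'p : IdemEquiv (1 - w * u * f) p := by
    refine .of_ker_eq ?_ ?_
    · linear_combination (norm := noncomm_ring) hw
    · linear_combination (norm := noncomm_ring) -hpw * u * f
  have hsp := hss'.trans is hp hs'p
  have hsmem := hsp.mem is hpmem
  have hc₁mem : c₁ ∈ 𝓕.toIdeal := by
    have := 𝓕.toIdeal.sub_mem hsmem h₁
    rwa [add_sub_cancel_left] at this
  have hc₂mem := hc.mem ic₂ hc₁mem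
  -- `1 - f u` itself need not be orthogonal to `c₂`; `m` has the same range and is.
  set m := (1 - f * u) * (1 - f * w * u) with hm
  have hmmem : m ∈ 𝓕.toIdeal := 𝓕.toIdeal.mul_mem_right _ _ h₂
  have hqn₂ : (1 - f * w * u) * (1 - f * u) = 1 - f * u := by
    linear_combination (norm := noncomm_ring) f * w * hufu
  have him : IsIdempotentElem m := by
    change m * m = m
    rw [hm, mul_assoc, ← mul_assoc _ (1 - f * u), hqn₂, ← mul_assoc, n₂.eq]
  have hmn₂ : IdemEquiv m (1 - f * u) := by
    refine .of_range_eq ?_ ?_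
    · rw [hm, ← mul_assoc, n₂.eq]
    · rw [hm, mul_assoc, hqn₂, n₂.eq]
  have hqm : 1 - f * w * u = m + c₂ := by rw [hm, hc₂]; noncomm_ring
  have hmc : m * c₂ = 0 := by
    rw [eq_sub_of_add_eq' hqm.symm, mul_sub, him.eq, sub_eq_zero, hm, mul_assoc, hq.eq]
  have hcm : c₂ * m = 0 := by
    rw [eq_sub_of_add_eq' hqm.symm, sub_mul, him.eq, sub_eq_zero, hm, ← mul_assoc, hqn₂]
  refine ⟨hqm ▸ 𝓕.toIdeal.add_mem hmmem hc₂mem, ?_⟩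
  rw [hqm, idemCls_add him ic₂ hmmem hc₂mem hmc hcm, ← idemCls_congr is hp hpmem hsp,
    idemCls_add n₁ ic₁ h₁ hc₁mem n₁c₁ c₁n₁, idemCls_congr him n₂ h₂ hmn₂,
    idemCls_congr ic₂ ic₁ hc₁mem hc]
  abel

end FiniteTypeIdeal

end CStar

/-! ### Operators and submodules in terms of elements of `A` -/

section Operators

variable {A : Type*} [CStarAlgebra A]

@[simp]
theorem leftMultiplier_apply (a x : A) : leftMultiplier a x = a * x := rfl

/-- Right linearity gives `T x = T (1 · x) = T(1) x`. -/
theorem eq_leftMultiplier (T : A →L[Aᵐᵒᵖ] A) : T = leftMultiplier (T 1) := by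
  ext x
  have := T.map_smul (MulOpposite.op x) 1
  simpa using this

theorem mul_mem_of_mem {M : Submodule Aᵐᵒᵖ A} {m : A} (hm : m ∈ M) (x : A) : m * x ∈ M :=
  M.smul_mem (MulOpposite.op x) hm

theorem mem_range_leftMultiplier {m : A} (hm : IsIdempotentElem m) {x : A} :
    x ∈ (leftMultiplier m).range ↔ m * x = x := by
  constructor
  · rintro ⟨y, rfl⟩
    change m * (m * y) = m * y
    rw [← mul_assoc, hm.eq]
  · exact fun h => ⟨x, h⟩

/-- A topological direct sum decomposition of the range of an idempotent is given by
idempotents. -/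
theorem IsTopDirectSum.exists_idempotents {e : A} (he : IsIdempotentElem e)
    {M N : Submodule Aᵐᵒᵖ A} (h : IsTopDirectSum (leftMultiplier e).range M N) :
    ∃ m n : A, m + n = e ∧ m ∈ M ∧ n ∈ N ∧ (∀ x ∈ M, m * x = x ∧ n * x = 0) ∧
      ∀ x ∈ N, m * x = 0 ∧ n * x = x := by
  have he1 : e ∈ M ⊔ N := h.sup_eq ▸ (mem_range_leftMultiplier he).2 he.eq
  -- The components of `e` generate the splitting: `x = e x = m x + n x` on the range of `e`.
  obtain ⟨m, hm, n, hn, hmn⟩ := Submodule.mem_sup.1 he1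
  have hle : ∀ x ∈ M ⊔ N, m * x + n * x = x := fun x hx => by
    rw [← add_mul, hmn]
    exact (mem_range_leftMultiplier he).1 (h.sup_eq ▸ hx)
  have hinf : ∀ x, x ∈ M → x ∈ N → x = 0 := fun x h1 h2 => by
    have : x ∈ M ⊓ N := ⟨h1, h2⟩
    rwa [h.inf_eq_bot] at this
  refine ⟨m, n, hmn, hm, hn, fun x hx => ?_, fun x hx => ?_⟩
  · have hs := hle x (Submodule.mem_sup_left hx)
    have h0 : n * x = 0 := by
      refine hinf _ ?_ (mul_mem_of_mem hn x)
      rw [eq_sub_of_add_eq' hs]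
      exact M.sub_mem hx (mul_mem_of_mem hm x)
    exact ⟨by rwa [h0, add_zero] at hs, h0⟩
  · have hs := hle x (Submodule.mem_sup_right hx)
    have h0 : m * x = 0 := by
      refine hinf _ (mul_mem_of_mem hm x) ?_
      rw [eq_sub_of_add_eq hs]
      exact N.sub_mem hx (mul_mem_of_mem hn x)
    exact ⟨h0, by rwa [h0, zero_add] at hs⟩

/-- A decomposition `e = m + n` into orthogonal idempotents decomposes the range of `e`. -/
theorem isTopDirectSum_of_idempotents {e m n : A} (hmn : m + n = e) (hm : IsIdempotentElem m)
    (hn : IsIdempotentElem n) (h₁ : m * n = 0) (h₂ : n * m = 0) :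
    IsTopDirectSum (leftMultiplier e).range (leftMultiplier m).range
      (leftMultiplier n).range := by
  have hclosed : ∀ {m : A}, IsIdempotentElem m →
      IsClosed ((leftMultiplier m).range : Set A) := fun {m} hm => by
    have : ((leftMultiplier m).range : Set A) = {x | m * x = x} := by
      ext x
      exact mem_range_leftMultiplier hm
    rw [this]
    exact isClosed_eq (by fun_prop) continuous_id
  have he : IsIdempotentElem e := by
    change e * e = e
    rw [← hmn, add_mul, mul_add, mul_add, hm.eq, hn.eq, h₁, h₂, add_zero, zero_add]
  refine ⟨hclosed hm, hclosed hn, ?_, le_antisymm (sup_le ?_ ?_) ?_⟩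
  · refine (Submodule.eq_bot_iff _).2 fun x hx => ?_
    have hx1 := (mem_range_leftMultiplier hm).1 hx.1
    have hx2 := (mem_range_leftMultiplier hn).1 hx.2
    rw [← hx1, ← hx2, ← mul_assoc, h₁, zero_mul]
  · intro x hx
    have hx1 := (mem_range_leftMultiplier hm).1 hx
    rw [mem_range_leftMultiplier he, ← hx1, ← mul_assoc, ← hmn, add_mul, hm.eq, h₂, add_zero]
  · intro x hx
    have hx1 := (mem_range_leftMultiplier hn).1 hx
    rw [mem_range_leftMultiplier he, ← hx1, ← mul_assoc, ← hmn, add_mul, hn.eq, h₁, zero_add]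
  · intro x hx
    have hx1 := (mem_range_leftMultiplier he).1 hx
    rw [← hx1, ← hmn, add_mul]
    exact Submodule.add_mem_sup ⟨x, rfl⟩ ⟨x, rfl⟩

/-- The relations between an idempotent and the orthogonal projection with the same range. -/
theorem IsOrthogonalProjectionOnto.mul_eq {p n : A} (hp : IsStarProjection p)
    {N : Submodule Aᵐᵒᵖ A} (h : IsOrthogonalProjectionOnto (leftMultiplier p) N)
    (hnN : n ∈ N) (hN : ∀ x ∈ N, n * x = x) : p * n = n ∧ n * p = p := by
  obtain ⟨h1, h2⟩ := h 1
  have h1 : p * 1 ∈ N := h1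
  have h2 : star n * (1 - p * 1) = 0 := h2 n hnN
  rw [mul_one] at h1 h2
  refine ⟨?_, hN p h1⟩
  have := congrArg star h2
  rw [star_mul, star_star, star_sub, star_one, hp.isSelfAdjoint.star_eq, star_zero, sub_mul,
    one_mul, sub_eq_zero] at this
  exact this.symm

theorem isOrthogonalProjectionOnto_of_mul_eq {p n : A} (hp : IsStarProjection p)
    (h₁ : p * n = n) (h₂ : n * p = p) :
    IsOrthogonalProjectionOnto (leftMultiplier p) (leftMultiplier n).range := by
  intro x
  refine ⟨⟨p * x, ?_⟩, ?_⟩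
  · change n * (p * x) = p * x
    rw [← mul_assoc, h₂]
  · rintro _ ⟨y, rfl⟩
    change star (n * y) * (x - p * x) = 0
    have : star n * p = star n := by
      rw [← hp.isSelfAdjoint.star_eq, ← star_mul, h₁]
    rw [star_mul, mul_assoc, mul_sub, ← mul_assoc (star n), this, sub_self, mul_zero]

end Operators

/-! ### Decompositions and outer inverses -/

namespace FiniteTypeIdeal

variable {A : Type*} [CStarAlgebra A] {𝓕 : FiniteTypeIdeal A}

/-- A decomposition of an operator on the range of `e` gives an outer inverse of it. -/
theorem IsDecomposition.exists_outerInverse {e t : A} (he : IsIdempotentElem e)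
    {M₁ N₁ M₂ N₂ : Submodule Aᵐᵒᵖ A} {p q : 𝓕.Proj}
    (h : 𝓕.IsDecomposition (leftMultiplier t) (leftMultiplier e).range M₁ N₁ M₂ N₂ p q) :
    ∃ u : A, e * u = u ∧ u * e = u ∧ u * t * u = u ∧
      e - u * t * e ∈ 𝓕.toIdeal ∧ e - t * u ∈ 𝓕.toIdeal ∧
      IdemEquiv (e - u * t * e) p.1 ∧ IdemEquiv (e - t * u) q.1 := by
  obtain ⟨m₁, n₁, hmn₁, hm₁, hn₁, hM₁, hN₁⟩ := h.domain.exists_idempotents he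
  obtain ⟨m₂, n₂, hmn₂, hm₂, hn₂, hM₂, hN₂⟩ := h.codomain.exists_idempotents he
  obtain ⟨φ, hφ⟩ := h.iso
  have hφ : ∀ x : M₁, (φ x : A) = t * x := hφ
  -- By right linearity, `L_u` is `φ⁻¹` on `M₂` and zero on `N₂`.
  set u : A := (φ.symm ⟨m₂, hm₂⟩ : A) with hu
  have huM : u ∈ M₁ := (φ.symm ⟨m₂, hm₂⟩).2
  have htu : t * u = m₂ := by rw [hu, ← hφ, φ.apply_symm_apply]
  have hsymm : ∀ y : M₂, (φ.symm y : A) = u * y := fun y => by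
    have : y = MulOpposite.op (y : A) • (⟨m₂, hm₂⟩ : M₂) :=
      Subtype.ext (hM₂ y y.2).1.symm
    conv_lhs => rw [this, map_smul]
    rfl
  have hum₂ : u * m₂ = u := (hsymm ⟨m₂, hm₂⟩).symm
  have hm₂e : m₂ * e = m₂ := by rw [← hmn₂, mul_add, (hM₂ _ hm₂).1, (hN₂ _ hn₂).1, add_zero]
  have hutm : u * t * m₁ = m₁ := by
    have h1 := hsymm (φ ⟨m₁, hm₁⟩)
    rw [φ.symm_apply_apply, hφ] at h1
    rw [mul_assoc]
    exact h1.symm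
  have hutn : u * t * n₁ = 0 := by
    have h1 : t * n₁ ∈ N₂ := h.map_compl n₁ hn₁
    rw [mul_assoc, ← hum₂, mul_assoc, (hN₂ _ h1).1, mul_zero]
  have hute : e - u * t * e = n₁ := by
    rw [← hmn₁, mul_add, hutm, hutn, add_zero, add_sub_cancel_left]
  have hetu : e - t * u = n₂ := by rw [htu, ← hmn₂, add_sub_cancel_left]
  have hp := h.proj_domain.mul_eq p.isProj hn₁ fun x hx => (hN₁ x hx).2
  have hq := h.proj_codomain.mul_eq q.isProj hn₂ fun x hx => (hN₂ x hx).2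
  refine ⟨u, ?_, ?_, ?_, ?_, ?_, ?_, ?_⟩
  · rw [← hmn₁, add_mul, (hM₁ u huM).1, (hM₁ u huM).2, add_zero]
  · rw [← hum₂, mul_assoc, hm₂e]
  · rw [mul_assoc, htu, hum₂]
  · rw [hute, ← hp.1]
    exact 𝓕.toIdeal.mul_mem_right _ _ p.2.1
  · rw [hetu, ← hq.1]
    exact 𝓕.toIdeal.mul_mem_right _ _ q.2.1
  · rw [hute]
    exact .of_range_eq hp.1 hp.2
  · rw [hetu]
    exact .of_range_eq hq.1 hq.2

/-- An outer inverse modulo `𝓕` of an operator on the range of `e` gives a decomposition. -/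
theorem exists_isDecomposition {e t u : A} (he : IsIdempotentElem e) (het : e * t = t)
    (heu : e * u = u) (hue : u * e = u) (hutu : u * t * u = u)
    (h₁ : e - u * t * e ∈ 𝓕.toIdeal) (h₂ : e - t * u ∈ 𝓕.toIdeal) :
    ∃ (M₁ N₁ M₂ N₂ : Submodule Aᵐᵒᵖ A) (p q : 𝓕.Proj),
      𝓕.IsDecomposition (leftMultiplier t) (leftMultiplier e).range M₁ N₁ M₂ N₂ p q := by
  have hee : e * e = e := he
  have im₁ : u * t * e * (u * t * e) = u * t * e := by
    linear_combination (norm := noncomm_ring) u * t * heu * t * e + hutu * t * e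
  have im₂ : t * u * (t * u) = t * u := by
    linear_combination (norm := noncomm_ring) t * hutu
  have mn₁ : u * t * e * (e - u * t * e) = 0 := by
    rw [mul_sub, im₁, mul_assoc, hee, sub_self]
  have nm₁ : (e - u * t * e) * (u * t * e) = 0 := by
    rw [sub_mul, im₁, ← mul_assoc, ← mul_assoc, heu, sub_self]
  have mn₂ : t * u * (e - t * u) = 0 := by
    rw [mul_sub, im₂, mul_assoc, hue, sub_self]
  have nm₂ : (e - t * u) * (t * u) = 0 := by
    rw [sub_mul, im₂, ← mul_assoc, het, sub_self]
  have in₁ : IsIdempotentElem (e - u * t * e) := by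
    change _ * _ = _
    rw [sub_mul _ _ (e - u * t * e), mn₁, sub_zero, mul_sub, hee, ← mul_assoc, ← mul_assoc, heu]
  have in₂ : IsIdempotentElem (e - t * u) := by
    change _ * _ = _
    rw [sub_mul _ _ (e - t * u), mn₂, sub_zero, mul_sub, hee, ← mul_assoc, het]
  obtain ⟨p, hp1, hp2⟩ := 𝓕.exists_range_proj in₁ h₁
  obtain ⟨q, hq1, hq2⟩ := 𝓕.exists_range_proj in₂ h₂
  have hM₁ : ∀ x ∈ (leftMultiplier (u * t * e)).range, u * t * x = x := fun x hx => by
    have hx := (mem_range_leftMultiplier im₁).1 hx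
    rw [← hx]
    linear_combination (norm := noncomm_ring) hutu * t * e * x
  have hM₂ : ∀ x ∈ (leftMultiplier (t * u)).range, t * u * x = x := fun x hx =>
    (mem_range_leftMultiplier im₂).1 hx
  have hmap : ∀ x ∈ (leftMultiplier (u * t * e)).range,
      leftMultiplier t x ∈ (leftMultiplier (t * u)).range := fun x hx => by
    refine ⟨t * x, ?_⟩
    change t * u * (t * x) = t * x
    conv_rhs => rw [← hM₁ x hx]
    simp only [mul_assoc]
  have hmap' : ∀ x ∈ (leftMultiplier (t * u)).range,
      leftMultiplier u x ∈ (leftMultiplier (u * t * e)).range := fun x hx => by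
    refine ⟨u * x, ?_⟩
    change u * t * e * (u * x) = u * x
    linear_combination (norm := noncomm_ring) u * t * heu * x + hutu * x
  -- The blocks are the ranges of `u t e`, `e - u t e`, `t u`, `e - t u`; `L_t` and `L_u` are
  -- mutually inverse between the first and the third.
  refine ⟨_, _, _, _, p, q, isTopDirectSum_of_idempotents (add_sub_cancel _ _) im₁ in₁ mn₁ nm₁,
    isTopDirectSum_of_idempotents (add_sub_cancel _ _) im₂ in₂ mn₂ nm₂,
    ⟨ContinuousLinearEquiv.equivOfInverse
      (((leftMultiplier t).comp (Submodule.subtypeL _)).codRestrict _ fun x => hmap x x.2)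
      (((leftMultiplier u).comp (Submodule.subtypeL _)).codRestrict _ fun x => hmap' x x.2)
      (fun x => Subtype.ext ?_) (fun x => Subtype.ext ?_), fun x => rfl⟩, ?_,
    isOrthogonalProjectionOnto_of_mul_eq p.isProj hp1 hp2,
    isOrthogonalProjectionOnto_of_mul_eq q.isProj hq1 hq2⟩
  · change u * (t * x.1) = x.1
    rw [← mul_assoc, hM₁ x.1 x.2]
  · change t * (u * x.1) = x.1
    rw [← mul_assoc, hM₂ x.1 x.2]
  · rintro _ ⟨x, rfl⟩
    refine ⟨t * e * x, ?_⟩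
    change (e - t * u) * (t * e * x) = t * ((e - u * t * e) * x)
    linear_combination (norm := noncomm_ring) het * e * x

/-! ### Independence of the index -/

variable (𝓕) in
/-- Compressing an element of `1 + 𝓕` to the range of `1 - p`, for a large enough projection
`p ∈ 𝓕`, yields a left invertible element. -/
theorem exists_proj_compression_leftInverse {x y : A} (hx : 1 - x ∈ 𝓕.toIdeal)
    (hy : 1 - y ∈ 𝓕.toIdeal) :
    ∃ p : 𝓕.Proj,
      (∃ w, p.1 * w = 0 ∧ w * x * (1 - p.1) = 1 - p.1) ∧
      ∃ w, p.1 * w = 0 ∧ w * y * (1 - p.1) = 1 - p.1 := by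
  obtain ⟨l, _, hl, hlim⟩ := 𝓕.exists_approx_unit
  have key : ∀ z : A, 1 - z ∈ 𝓕.toIdeal → ∀ᶠ p in l, IsStarProjection p →
      ∃ w, p * w = 0 ∧ w * z * (1 - p) = 1 - p := by
    intro z hz
    have ht := ((hlim _ hz).2.const_sub (1 - z)).norm
    rw [sub_self, norm_zero] at ht
    filter_upwards [ht.eventually_lt_const one_pos] with p hlt hp
    have hpp : p * p = p := hp.isIdempotentElem
    set r := 1 - p with hr
    have hrp : IsStarProjection r := hp.one_sub
    have hrr : r * r = r := hrp.isIdempotentElem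
    have hnorm : ‖r * (1 - z) * r‖ < 1 := by
      have hb : (1 - z) * r = 1 - z - (1 - z) * p := by rw [hr, mul_sub, mul_one]
      rw [mul_assoc, hb]
      calc _ ≤ ‖r‖ * _ := norm_mul_le _ _
        _ ≤ 1 * _ := by gcongr; exact hrp.norm_le
        _ < 1 := by rwa [one_mul]
    -- Neumann series: `c = 1 - r (1 - z) r` commutes with `r` and satisfies `r z r = c r`, so `w =
    -- c⁻¹ r` works.
    obtain ⟨c, hc⟩ := isUnit_one_sub_of_norm_lt_one hnorm
    have hrc : (c : A) * r = r * c := by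
      rw [hc]
      linear_combination (norm := noncomm_ring) hrr * (1 - z) * r - r * (1 - z) * hrr
    have hrc' : (↑c⁻¹ : A) * r = r * ↑c⁻¹ := Commute.units_inv_left (hrc : Commute (c : A) r)
    have hrzr : r * z * r = c * r := by
      rw [hc]
      linear_combination (norm := noncomm_ring) r * (1 - z) * hrr + hrr
    have hpr : p * r = 0 := by rw [hr, mul_sub, hpp, mul_one, sub_self]
    refine ⟨↑c⁻¹ * r, ?_, ?_⟩
    · rw [hrc', ← mul_assoc, hpr, zero_mul]
    · rw [mul_assoc, mul_assoc, ← mul_assoc r, hrzr, ← mul_assoc, c.inv_mul, one_mul]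
  -- Each property holds eventually along the approximate unit, so a single `p` serves `x` and `y`.
  obtain ⟨p, ⟨hp, hp'⟩, h1, h2⟩ := (hl.and ((key x hx).and (key y hy))).exists
  exact ⟨⟨p, hp, hp'⟩, h1 hp', h2 hp'⟩

/-- The index computed from an outer inverse of `f` modulo `𝓕` does not depend on it. -/
theorem idemCls_sub_eq {f u v : A} (hu : u * f * u = u) (hv : v * f * v = v)
    (hu₁ : 1 - u * f ∈ 𝓕.toIdeal) (hu₂ : 1 - f * u ∈ 𝓕.toIdeal)
    (hv₁ : 1 - v * f ∈ 𝓕.toIdeal) (hv₂ : 1 - f * v ∈ 𝓕.toIdeal) :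
    𝓕.idemCls (1 - u * f) - 𝓕.idemCls (1 - f * u) =
      𝓕.idemCls (1 - v * f) - 𝓕.idemCls (1 - f * v) := by
  obtain ⟨p, ⟨w, hpw, hw⟩, x, hpx, hx⟩ :=
    𝓕.exists_proj_compression_leftInverse hu₁ hv₁
  have hw : w * u * f * (1 - p.1) = 1 - p.1 := by rwa [mul_assoc w]
  have hx : x * v * f * (1 - p.1) = 1 - p.1 := by rwa [mul_assoc x]
  obtain ⟨-, hw'⟩ := idemCls_sub_eq_of_leftInverse hu hu₁ hu₂ p.isProj.isIdempotentElem p.2.1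
    hpw hw
  obtain ⟨hmem, hx'⟩ := idemCls_sub_eq_of_leftInverse hv hv₁ hv₂ p.isProj.isIdempotentElem p.2.1
    hpx hx
  have h1 : w * u * f * w = w := by
    linear_combination (norm := noncomm_ring) hw * w + (w * u * f) * hpw - hpw
  have h2 : x * v * f * x = x := by
    linear_combination (norm := noncomm_ring) hx * x + (x * v * f) * hpx - hpx
  -- `w u f` fixes `(1 - p)A`, which contains `x`; symmetrically for `x v f` and `w`.
  have h3 : w * u * f * x = x := by
    linear_combination (norm := noncomm_ring) hw * x + (w * u * f) * hpx - hpx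
  have h4 : x * v * f * w = w := by
    linear_combination (norm := noncomm_ring) hx * w + (x * v * f) * hpw - hpw
  rw [hw', hx', idemCls_congr (n := 1 - f * w * u) (m := 1 - f * x * v) ?_ ?_ hmem]
  · refine .of_ker_eq ?_ ?_
    · linear_combination (norm := noncomm_ring) f * h3 * v
    · linear_combination (norm := noncomm_ring) f * h4 * u
  · change _ * _ = _
    linear_combination (norm := noncomm_ring) f * h1 * u
  · change _ * _ = _
    linear_combination (norm := noncomm_ring) f * h2 * v

end FiniteTypeIdeal

/-! ### Passing between `A` and the corner of `e` -/

namespace FiniteTypeIdeal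

variable {A : Type*} [CStarAlgebra A] {𝓕 : FiniteTypeIdeal A}

/-- Lets membership in `𝓕` be checked by computing in `A / 𝓕`, where `e` becomes `1`. -/
theorem mem_iff_mk'_eq_zero {a : A} : a ∈ 𝓕.toIdeal ↔ 𝓕.toIdeal.ringCon.mk' a = 0 := by
  rw [← TwoSidedIdeal.mem_ker, TwoSidedIdeal.ker_ringCon_mk']

theorem one_sub_mem_iff {a : A} : 1 - a ∈ 𝓕.toIdeal ↔ 𝓕.toIdeal.ringCon.mk' a = 1 := by
  rw [mem_iff_mk'_eq_zero, map_sub, map_one, sub_eq_zero, eq_comm]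

/-- An outer inverse modulo `𝓕` living in the corner of `e` is one in the whole algebra, with the
same index. -/
theorem idemCls_sub_corner {e f u : A} (he : IsIdempotentElem e) (hemem : 1 - e ∈ 𝓕.toIdeal)
    (heu : e * u = u) (hue : u * e = u) (hufu : u * f * u = u)
    (h₁ : e - u * f * e ∈ 𝓕.toIdeal) (h₂ : e - e * f * u ∈ 𝓕.toIdeal) :
    1 - u * f ∈ 𝓕.toIdeal ∧ 1 - f * u ∈ 𝓕.toIdeal ∧
    𝓕.idemCls (1 - u * f) - 𝓕.idemCls (1 - f * u) =
      𝓕.idemCls (e - u * f * e) - 𝓕.idemCls (e - e * f * u) := by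
  have hee : e * e = e := he
  have a₁ : 1 - u * f * e = (1 - e) + (e - u * f * e) := by abel
  have a₂ : 1 - e * f * u = (1 - e) + (e - e * f * u) := by abel
  have m₁ : 1 - u * f * e ∈ 𝓕.toIdeal := a₁ ▸ 𝓕.toIdeal.add_mem hemem h₁
  have m₂ : 1 - e * f * u ∈ 𝓕.toIdeal := a₂ ▸ 𝓕.toIdeal.add_mem hemem h₂
  have i₁ : IsIdempotentElem (1 - u * f) := by
    change _ * _ = _
    linear_combination (norm := noncomm_ring) hufu * f
  have i₂ : IsIdempotentElem (1 - f * u) := by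
    change _ * _ = _
    linear_combination (norm := noncomm_ring) f * hufu
  have j₁ : IsIdempotentElem (1 - u * f * e) := by
    change _ * _ = _
    linear_combination (norm := noncomm_ring) u * f * heu * f * e + hufu * f * e
  have j₂ : IsIdempotentElem (1 - e * f * u) := by
    change _ * _ = _
    linear_combination (norm := noncomm_ring) e * f * hue * f * u + e * f * hufu
  have k₁ : IsIdempotentElem (e - u * f * e) := by
    change _ * _ = _
    linear_combination (norm := noncomm_ring)
      hee - heu * f * e - u * f * hee + u * f * heu * f * e + hufu * f * e
  have k₂ : IsIdempotentElem (e - e * f * u) := by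
    change _ * _ = _
    linear_combination (norm := noncomm_ring)
      hee - hee * f * u - e * f * hue + e * f * hue * f * u + e * f * hufu
  -- Both kernels are `u A`.
  have q₁ : IdemEquiv (1 - u * f) (1 - u * f * e) := by
    refine .of_ker_eq ?_ ?_
    · linear_combination (norm := noncomm_ring) hufu * f * e
    · linear_combination (norm := noncomm_ring) u * f * heu * f + hufu * f
  -- Both ranges are the kernel of `L_u`.
  have q₂ : IdemEquiv (1 - f * u) (1 - e * f * u) := by
    refine .of_range_eq ?_ ?_
    · linear_combination (norm := noncomm_ring) e * f * hufu
    · linear_combination (norm := noncomm_ring) f * hue * f * u + f * hufu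
  refine ⟨q₁.mem i₁ m₁, q₂.mem i₂ m₂, ?_⟩
  rw [idemCls_congr i₁ j₁ m₁ q₁, idemCls_congr i₂ j₂ m₂ q₂, a₁, a₂,
    idemCls_add he.one_sub k₁ hemem h₁, idemCls_add he.one_sub k₂ hemem h₂]
  · abel
  · linear_combination (norm := noncomm_ring) -hee + hee * f * u
  · linear_combination (norm := noncomm_ring) -hee + e * f * hue
  · linear_combination (norm := noncomm_ring) -hee + heu * f * e
  · linear_combination (norm := noncomm_ring) -hee + u * f * hee

/-- An element invertible modulo `𝓕` has an outer inverse modulo `𝓕` in the corner of any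
idempotent `e` with `1 - e ∈ 𝓕`. -/
theorem exists_outerInverse_corner {e f u : A} (he : IsIdempotentElem e)
    (hemem : 1 - e ∈ 𝓕.toIdeal) (h₁ : 1 - u * f ∈ 𝓕.toIdeal) (h₂ : 1 - f * u ∈ 𝓕.toIdeal) :
    ∃ v : A, e * v = v ∧ v * e = v ∧ v * f * v = v ∧
      e - v * f * e ∈ 𝓕.toIdeal ∧ e - e * f * v ∈ 𝓕.toIdeal := by
  have hee : e * e = e := he
  rw [one_sub_mem_iff] at hemem h₁ h₂
  rw [map_mul] at h₁ h₂
  have hx : 1 - e * u * e * f * e ∈ 𝓕.toIdeal := by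
    rw [one_sub_mem_iff]
    simp only [map_mul, hemem, mul_one, one_mul, h₁]
  obtain ⟨p, ⟨w, hpw, hw⟩, -⟩ := 𝓕.exists_proj_compression_leftInverse hx hx
  -- The compression turns an inverse modulo `𝓕` into an exact outer inverse; `w` is still `1`
  -- modulo `𝓕`.
  have hwxw : w * (e * u * e * f * e) * w = w := by
    linear_combination (norm := noncomm_ring)
      hw * w + w * (e * u * e * f * e) * hpw - hpw
  have hp := mem_iff_mk'_eq_zero.1 p.2.1
  have hw1 : 𝓕.toIdeal.ringCon.mk' w = 1 := by
    have := congrArg 𝓕.toIdeal.ringCon.mk' hw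
    simpa only [map_mul, map_sub, map_one, hp, sub_zero, one_sub_mem_iff.1 hx, mul_one] using this
  refine ⟨e * w * (e * u * e), ?_, ?_, ?_, ?_, ?_⟩
  · linear_combination (norm := noncomm_ring) hee * w * (e * u * e)
  · linear_combination (norm := noncomm_ring) e * w * e * u * hee
  · linear_combination (norm := noncomm_ring) e * hwxw * (e * u * e)
  · rw [mem_iff_mk'_eq_zero]
    simp only [map_mul, map_sub, hemem, hw1, mul_one, one_mul, h₁, sub_self]
  · rw [mem_iff_mk'_eq_zero]
    simp only [map_mul, map_sub, hemem, hw1, mul_one, one_mul, h₂, sub_self]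

theorem range_leftMultiplier_one : (leftMultiplier (1 : A)).range = ⊤ :=
  Submodule.eq_top_iff'.2 fun x => ⟨x, one_mul x⟩

theorem IsDecomposition.exists_outerInverse_top {f : A} {M₁ N₁ M₂ N₂ : Submodule Aᵐᵒᵖ A}
    {p q : 𝓕.Proj} (h : 𝓕.IsDecomposition (leftMultiplier f) ⊤ M₁ N₁ M₂ N₂ p q) :
    ∃ u : A, u * f * u = u ∧ 1 - u * f ∈ 𝓕.toIdeal ∧ 1 - f * u ∈ 𝓕.toIdeal ∧
      𝓕.cls p - 𝓕.cls q = 𝓕.idemCls (1 - u * f) - 𝓕.idemCls (1 - f * u) := by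
  rw [← range_leftMultiplier_one] at h
  obtain ⟨u, -, -, hu, h₁, h₂, hp, hq⟩ := h.exists_outerInverse .one
  rw [mul_one] at h₁ hp
  exact ⟨u, hu, h₁, h₂, by rw [idemCls_eq_cls hp, idemCls_eq_cls hq]⟩

/-- The chosen decomposition and the given one both yield outer inverses of the same element, and
`idemCls_sub_eq` compares these. -/
theorem index_eq {F : A →L[Aᵐᵒᵖ] A} {M₁ N₁ M₂ N₂ : Submodule Aᵐᵒᵖ A}
    {p q : 𝓕.Proj} (h : 𝓕.IsDecomposition F ⊤ M₁ N₁ M₂ N₂ p q) :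
    𝓕.index F = 𝓕.cls p - 𝓕.cls q := by
  have hex : ∃ k : 𝓕.K, ∃ (M₁ N₁ M₂ N₂ : Submodule Aᵐᵒᵖ A) (p q : 𝓕.Proj),
      𝓕.IsDecomposition F ⊤ M₁ N₁ M₂ N₂ p q ∧ k = 𝓕.cls p - 𝓕.cls q :=
    ⟨_, _, _, _, _, _, _, h, rfl⟩
  rw [index, dif_pos hex]
  obtain ⟨M₁', N₁', M₂', N₂', p', q', h', hk⟩ := hex.choose_spec
  rw [hk]
  rw [eq_leftMultiplier F] at h h'
  obtain ⟨u, hu, hu₁, hu₂, hpq⟩ := h.exists_outerInverse_top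
  obtain ⟨v, hv, hv₁, hv₂, hpq'⟩ := h'.exists_outerInverse_top
  rw [hpq, hpq', idemCls_sub_eq hu hv hu₁ hu₂ hv₁ hv₂]

/-- A decomposition of `E F` on the range of `E` yields one of `F` with the same index. -/
theorem IsDecomposition.exists_top {e f : A} (he : IsIdempotentElem e)
    (hemem : 1 - e ∈ 𝓕.toIdeal) {M N M' N' : Submodule Aᵐᵒᵖ A} {p q : 𝓕.Proj}
    (h : 𝓕.IsDecomposition (leftMultiplier (e * f)) (leftMultiplier e).range M N M' N' p q) :
    ∃ (M₁ N₁ M₂ N₂ : Submodule Aᵐᵒᵖ A) (p' q' : 𝓕.Proj),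
      𝓕.IsDecomposition (leftMultiplier f) ⊤ M₁ N₁ M₂ N₂ p' q' ∧
      𝓕.cls p' - 𝓕.cls q' = 𝓕.cls p - 𝓕.cls q := by
  obtain ⟨u, heu, hue, hu, h₁, h₂, hp, hq⟩ := h.exists_outerInverse he
  have hef : u * (e * f) = u * f := by rw [← mul_assoc, hue]
  rw [hef] at hu h₁ hp
  obtain ⟨m₁, m₂, hcls⟩ := idemCls_sub_corner he hemem heu hue hu h₁ h₂
  obtain ⟨M₁, N₁, M₂, N₂, p', q', h'⟩ := exists_isDecomposition (𝓕 := 𝓕) (e := 1) (t := f) (u := u)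
    .one (one_mul _) (one_mul _) (mul_one _) hu (by rwa [mul_one]) m₂
  rw [range_leftMultiplier_one] at h'
  refine ⟨M₁, N₁, M₂, N₂, p', q', h', ?_⟩
  -- The outer inverse `v` read off from the new decomposition is not known to be `u`; independence
  -- of the index bridges the two.
  obtain ⟨v, hv, hv₁, hv₂, hpq⟩ := h'.exists_outerInverse_top
  rw [hpq, ← idemCls_eq_cls hp, ← idemCls_eq_cls hq, ← hcls,
    idemCls_sub_eq hv hu hv₁ hv₂ m₁ m₂]

end FiniteTypeIdeal

/-! ### The proposition -/

theorem mainTheorem3 {A : Type*} [CStarAlgebra A] (𝓕 : FiniteTypeIdeal A)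
    (F E : A →L[Aᵐᵒᵖ] A) (hE : IsIdempotentElem E) (hfin : 1 - E ∈ 𝓕.operators) :
    (F ∈ 𝓕.MKPhi ↔
      ∃ (M N M' N' : Submodule Aᵐᵒᵖ A) (p q : 𝓕.Proj),
        𝓕.IsDecomposition (E ∘L F) E.range M N M' N' p q) ∧
    (∀ (M N M' N' : Submodule Aᵐᵒᵖ A) (p q : 𝓕.Proj),
      𝓕.IsDecomposition (E ∘L F) E.range M N M' N' p q →
        𝓕.index F = 𝓕.cls p - 𝓕.cls q) ∧
    -- `index F` does not depend on the decomposition of `F` used to compute it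
    (∀ (M₁ N₁ M₂ N₂ : Submodule Aᵐᵒᵖ A) (p q : 𝓕.Proj),
      𝓕.IsDecomposition F ⊤ M₁ N₁ M₂ N₂ p q →
        𝓕.index F = 𝓕.cls p - 𝓕.cls q) := by
  obtain ⟨e, rfl⟩ : ∃ e, E = leftMultiplier e := ⟨_, eq_leftMultiplier E⟩
  obtain ⟨f, rfl⟩ : ∃ f, F = leftMultiplier f := ⟨_, eq_leftMultiplier F⟩
  have he : IsIdempotentElem e := by
    have := congrArg (fun T : A →L[Aᵐᵒᵖ] A => T 1) hE.eq
    change e * (e * 1) = e * 1 at this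
    rwa [mul_one] at this
  have hemem : 1 - e ∈ 𝓕.toIdeal := by
    obtain ⟨a, ha, hae⟩ := hfin
    have := congrArg (fun T : A →L[Aᵐᵒᵖ] A => T 1) hae
    change a * 1 = 1 - e * 1 at this
    rw [mul_one, mul_one] at this
    exact this ▸ ha
  have hcomp : leftMultiplier e ∘L leftMultiplier f = leftMultiplier (e * f) := by
    ext x
    exact (mul_assoc e f x).symm
  rw [hcomp]
  refine ⟨⟨?_, ?_⟩, ?_, fun _ _ _ _ _ _ h => FiniteTypeIdeal.index_eq h⟩
  · rintro ⟨M₁, N₁, M₂, N₂, p, q, h⟩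
    obtain ⟨u, -, h₁, h₂, -⟩ := h.exists_outerInverse_top
    obtain ⟨v, hev, hve, hv, hv₁, hv₂⟩ :=
      FiniteTypeIdeal.exists_outerInverse_corner he hemem h₁ h₂
    have hef : v * (e * f) = v * f := by rw [← mul_assoc, hve]
    refine FiniteTypeIdeal.exists_isDecomposition he (by rw [← mul_assoc, he.eq]) hev hve ?_ ?_ hv₂
    · rw [hef, hv]
    · rwa [hef]
  · rintro ⟨M, N, M', N', p, q, h⟩
    obtain ⟨M₁, N₁, M₂, N₂, p', q', h', -⟩ := h.exists_top he hemem
    exact ⟨M₁, N₁, M₂, N₂, p', q', h'⟩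
  · intro M N M' N' p q h
    obtain ⟨M₁, N₁, M₂, N₂, p', q', h', hcls⟩ := h.exists_top he hemem
    rw [FiniteTypeIdeal.index_eq h', hcls]
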